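/- Let $k$ be an algebraically closed field of characteristic two, and let $X$ be a curve over $k$, i.e. an integral scheme that is proper and smooth of relative dimension one over $k$, with function field $k(X)$. For a closed point $x\in X$ let $v_x$ be the normalized valuation of $k(X)$ at $x$. A rational function $f\in k(X)$ is called pseudo-tame at $x$ if there is $h\in\mathcal O_{X,x}$ such that $v_x(t+h^4)$ is a (finite) odd integer, where $t$ is the pullback along $f$ of a uniformizer of $\mathbb P^1_k$ at $f(x)$, namely $t=f-c$ if $f(x)=c\in k$ and $t=1/f$ if $f(x)=\infty$; it is pseudo-tame on an open set $U$ if it is pseudo-tame at all closed points of $U$. For $f,g\in k(X)\setminus k(X)^2$ write (uniquely) $f=f_0^4+f_1^4g+f_2^4g^2+f_3^4g^3$ with $f_i\in k(X)$ and put $$a(f,g)=\frac{(f_1^2f_3^2+f_2^4)\,g}{f_3^4g^2+f_1^4}\ \bmod k(X)^2\ \in\ k(X)/k(X)^2 .$$ Let $B_X=\mathcal O_X/\mathcal O_X^2$. For a nonempty open $W\subset X$, a section $s\in H^0(W,B_X)$ is said to correspond to $c\in k(X)/k(X)^2$ if every point of $W$ has an open neighbourhood $V\subset W$ on which $s$ is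 the class of a regular function on $V$ whose class in $k(X)/k(X)^2$ is $c$. Consider pairs $(\mathcal U,(f_i)_{i\in I})$, where $\mathcal U=(U_i)_{i\in I}$ is a covering of $X$ by nonempty open subsets and $f_i\in k(X)$ is pseudo-tame on $U_i$ for each $i\in I$. Then: (1) For each such pair there is a unique \v{C}ech $1$-cocycle $(\beta_{i,j})$ of $B_X$ for the covering $\mathcal U$ such that $\beta_{i,j}\in H^0(U_i\cap U_j,B_X)$ corresponds to $a(f_i,f_j)$ for all $i,j\in I$. Let $\beta(X,\mathcal U,(f_i))\in H^1(X,B_X)$ denote its class in sheaf cohomology. (2) The class $\beta(X,\mathcal U,(f_i))$ is independent of the choice of $\mathcal U$ and $(f_i)_{i\in I}$, and such pairs exist; that is, there is a unique class $\beta(X)\in H^1(X,B_X)$ with $\beta(X)=\beta(X,\mathcal U,(f_i))$ for all pairs $(\mathcal U,(f_i))$ as above. -/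

import Mathlib

open CategoryTheory TopologicalSpace Opposite AlgebraicGeometry

universe u

noncomputable section

/-! ### From Čech cocycles to sheaf cohomology -/

/-- Sheaves of abelian groups on a topological space. -/
abbrev AbSheaf (T : TopCat.{u}) : Type (u + 1) :=
  Sheaf (Opens.grothendieckTopology T) AddCommGrpCat.{u}

namespace CechH1

variable {T : TopCat.{u}} (F : AbSheaf T) {ι : Type u} (U : ι → Opens T)

/-- Restriction of sections of a sheaf of abelian groups. -/
abbrev res {V W : Opens T} (h : V ≤ W) (s : F.obj.obj (op W)) : F.obj.obj (op V) :=
  F.obj.map (homOfLE h).op s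

lemma res_res {V W Z : Opens T} (h : V ≤ W) (h' : W ≤ Z) (s : F.obj.obj (op Z)) :
    res F h (res F h' s) = res F (h.trans h') s := by
  simp only [res]
  rw [← ConcreteCategory.comp_apply, ← F.obj.map_comp]
  rfl

/-- A Čech 1-cocycle of `F` for the family `U`: sections `s i j` over `U i ⊓ U j` with
`s i j + s j k = s i k` over `U i ⊓ U j ⊓ U k`. -/
@[ext]
structure OneCocycle where
  sec : ∀ i j : ι, F.obj.obj (op (U i ⊓ U j))
  cocycle : ∀ i j k : ι,
    res F (V := U i ⊓ U j ⊓ U k) inf_le_left (sec i j) +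
      res F (V := U i ⊓ U j ⊓ U k) (le_inf (inf_le_left.trans inf_le_right) inf_le_right)
        (sec j k) =
      res F (V := U i ⊓ U j ⊓ U k) (le_inf (inf_le_left.trans inf_le_left) inf_le_right)
        (sec i k)

/-- The presheaf `V ↦ ∏ i, F (V ⊓ U i)`. -/
def cochainPresheaf : TopCat.Presheaf AddCommGrpCat.{u} T where
  obj V := AddCommGrpCat.of (∀ i, F.obj.obj (op (V.unop ⊓ U i)))
  map {V W} f := AddCommGrpCat.ofHom
    { toFun := fun t i => res F (inf_le_inf_right (U i) f.unop.le) (t i)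
      map_zero' := by ext i; simp [res]
      map_add' := fun a b => by ext i; simp [res] }
  map_id V := by
    ext t i
    change F.obj.map (𝟙 _) (t i) = t i
    simp
  map_comp {V W Z} f g := by
    ext t i
    exact (res_res F _ _ _).symm

lemma cochainPresheaf_map_apply {V W : (Opens T)ᵒᵖ} (f : V ⟶ W)
    (t : (cochainPresheaf F U).obj V) (i : ι) :
    ((cochainPresheaf F U).map f t : ∀ i, F.obj.obj (op (W.unop ⊓ U i))) i =
      res F (inf_le_inf_right (U i) f.unop.le) ((t : ∀ i, F.obj.obj (op (V.unop ⊓ U i))) i) :=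
  rfl

lemma cochainPresheaf_isSheaf : (cochainPresheaf F U).IsSheaf := by
  rw [TopCat.Presheaf.isSheaf_iff_isSheafUniqueGluing]
  intro κ V sf hsf
  have key : ∀ i : ι, ∃! s : F.obj.obj (op (iSup V ⊓ U i)), ∀ j : κ,
      F.obj.map (homOfLE (inf_le_inf_right (U i) (le_iSup V j))).op s =
        (sf j : ∀ i, F.obj.obj (op (V j ⊓ U i))) i := by
    intro i
    refine TopCat.Sheaf.existsUnique_gluing' F (fun j => V j ⊓ U i) (iSup V ⊓ U i)
      (fun j => homOfLE (inf_le_inf_right (U i) (le_iSup V j))) (by rw [iSup_inf_eq]) _ ?_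
    intro j k
    have h := congrFun (hsf j k) i
    have h' := congrArg (res F (V := V j ⊓ U i ⊓ (V k ⊓ U i)) (W := V j ⊓ V k ⊓ U i)
      (le_inf (inf_le_inf inf_le_left inf_le_left) (inf_le_left.trans inf_le_right))) h
    rw [cochainPresheaf_map_apply, cochainPresheaf_map_apply] at h'
    erw [res_res, res_res] at h'
    exact h'
  choose s hs hu using key
  refine ⟨s, fun j => funext fun i => hs i j, fun t ht => funext fun i => hu i _ fun j => ?_⟩
  exact congrFun (ht j) i

/-- The sheaf `V ↦ ∏ i, F (V ⊓ U i)` of Čech 0-cochains. -/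
def cochainSheaf : AbSheaf T :=
  ⟨cochainPresheaf F U, cochainPresheaf_isSheaf F U⟩

/-- The map sending a section of `F` to the family of its restrictions to the `U i`. -/
def toCochain : F ⟶ cochainSheaf F U where
  hom :=
    { app := fun V => AddCommGrpCat.ofHom
        { toFun := fun s i => res F inf_le_left s
          map_zero' := by ext i; simp [res]
          map_add' := fun a b => by ext i; simp [res] }
      naturality := fun V W f => by
        ext s
        funext i
        exact (res_res F (Z := V.unop) _ f.unop.le s).trans (res_res F _ _ s).symm }

variable {U}

lemma toCochain_mono (hU : iSup U = ⊤) : Mono (toCochain F U) := by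
  have : Mono (toCochain F U).hom := by
    have : ∀ V, Mono ((toCochain F U).hom.app V) := by
      intro V
      rw [AddCommGrpCat.mono_iff_injective]
      intro a b hab
      refine TopCat.Sheaf.eq_of_locally_eq' F (fun i => V.unop ⊓ U i) V.unop
        (fun i => homOfLE inf_le_left) (by rw [← inf_iSup_eq, hU, inf_top_eq]) a b ?_
      exact fun i => congrFun hab i
    exact NatTrans.mono_of_mono_app _
  exact (sheafToPresheaf _ _).mono_of_mono_map this

/-- The short complex `0 ⟶ F ⟶ C⁰ ⟶ C⁰ / F ⟶ 0`. -/
abbrev cochainSequence : ShortComplex (AbSheaf T) :=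
  ShortComplex.mk (toCochain F U) (Limits.cokernel.π (toCochain F U))
    (Limits.cokernel.condition _)

lemma cochainSequence_shortExact (hU : iSup U = ⊤) : (cochainSequence F (U := U)).ShortExact := by
  have := toCochain_mono F hU
  exact { exact := ShortComplex.exact_cokernel _ }

variable {F}

/-- The 0-cochain `(s j i)_i` over `U j`. -/
def OneCocycle.lift (s : OneCocycle F U) (j : ι) : (cochainSheaf F U).obj.obj (op (U j)) :=
  (fun i => s.sec j i : ∀ i, F.obj.obj (op (U j ⊓ U i)))

/-- Over `U j ⊓ U k` the cochains `s.lift j` and `s.lift k` differ by the image of `s j k`. -/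
lemma OneCocycle.lift_eq (s : OneCocycle F U) (j k : ι) :
    (cochainSheaf F U).obj.map (TopologicalSpace.Opens.infLELeft (U j) (U k)).op (s.lift j) =
      (toCochain F U).hom.app (op (U j ⊓ U k)) (s.sec j k) +
        (cochainSheaf F U).obj.map (TopologicalSpace.Opens.infLERight (U j) (U k)).op
          (s.lift k) := by
  funext i
  exact (s.cocycle j k i).symm

/-- The images of the `s.lift j` in `C⁰ / F` glue to a unique global section. -/
lemma OneCocycle.existsUnique_glue (hU : iSup U = ⊤) (s : OneCocycle F U) :
    ∃! q : (cochainSequence F (U := U)).X₃.obj.obj (op ⊤), ∀ j,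
      (cochainSequence F (U := U)).X₃.obj.map (homOfLE (le_top (a := U j))).op q =
        (cochainSequence F (U := U)).g.hom.app (op (U j)) (s.lift j) := by
  refine TopCat.Sheaf.existsUnique_gluing' (cochainSequence F (U := U)).X₃ U ⊤ (fun j => homOfLE le_top)
    hU.ge _ ?_
  intro j k
  have h := congrArg ((cochainSequence F (U := U)).g.hom.app (op (U j ⊓ U k))) (s.lift_eq j k)
  rw [map_add, NatTrans.naturality_apply, NatTrans.naturality_apply] at h
  have h0 : (cochainSequence F (U := U)).g.hom.app (op (U j ⊓ U k))
      ((toCochain F U).hom.app (op (U j ⊓ U k)) (s.sec j k)) = 0 := by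
    rw [← ConcreteCategory.comp_apply]
    have := congrArg (fun φ => φ.hom.app (op (U j ⊓ U k))) (cochainSequence F (U := U)).zero
    exact congrArg (fun φ => φ (s.sec j k)) (congrArg AddCommGrpCat.Hom.hom this)
  rw [h0, zero_add] at h
  exact h

/-- The class in the sheaf cohomology group `H¹(T, F)` of a Čech 1-cocycle `s` for an open covering
`U` of `T`: the image under the connecting homomorphism `H⁰(T, C⁰/F) ⟶ H¹(T, F)` of the global
section of `C⁰/F` whose restriction to `U j` is the class of the cochain `(s j i)_i`. -/
def OneCocycle.cohomologyClass (hU : iSup U = ⊤) (s : OneCocycle F U) : Sheaf.H.{u} F 1 :=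
  ((Sheaf.H.equiv₀ (cochainSequence F (U := U)).X₃
      (Limits.isTerminalTop (α := Opens T))).symm
        (s.existsUnique_glue hU).choose).comp
    (cochainSequence_shortExact F hU).extClass (zero_add 1)

end CechH1

/-! ### The quotient of a ring of characteristic two by its squares -/

/-- The additive subgroup generated by the squares of a commutative ring. In characteristic two
every element of it is a square. -/
def squares (R : Type*) [CommRing R] : AddSubgroup R :=
  AddSubgroup.closure (Set.range fun r : R => r ^ 2)

lemma mem_squares_iff {R : Type*} [CommRing R] [CharP R 2] (x : R) :
    x ∈ squares R ↔ ∃ r : R, r ^ 2 = x := by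
  constructor
  · intro hx
    induction hx using AddSubgroup.closure_induction with
    | mem x h => exact h
    | zero => exact ⟨0, by simp⟩
    | add x y _ _ hx hy =>
      obtain ⟨r, rfl⟩ := hx
      obtain ⟨s, rfl⟩ := hy
      exact ⟨r + s, add_pow_char r s 2⟩
    | neg x _ hx =>
      obtain ⟨r, rfl⟩ := hx
      exact ⟨r, (CharTwo.neg_eq _).symm⟩
  · rintro ⟨r, rfl⟩
    exact AddSubgroup.subset_closure ⟨r, rfl⟩

/-- The abelian group `R / R²`. -/
abbrev ModSquares (R : Type*) [CommRing R] : Type _ := R ⧸ squares R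

/-- The map `R / R² → S / S²` induced by a ring homomorphism `R → S`. -/
def ModSquares.map {R S : Type*} [CommRing R] [CommRing S] (φ : R →+* S) :
    ModSquares R →+ ModSquares S :=
  QuotientAddGroup.map (squares R) (squares S) φ.toAddMonoidHom <| by
    rw [squares, AddSubgroup.closure_le]
    rintro _ ⟨r, rfl⟩
    exact AddSubgroup.subset_closure ⟨φ r, by simp⟩

/-- The functor `R ↦ R / R²`. -/
def modSquaresFunctor : CommRingCat.{u} ⥤ AddCommGrpCat.{u} where
  obj R := AddCommGrpCat.of (ModSquares R)
  map φ := AddCommGrpCat.ofHom (ModSquares.map φ.hom)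
  map_id R := by
    ext x
    rfl
  map_comp φ ψ := by
    ext x
    rfl

/-- For elements `f, g` of a field `K` of characteristic two and a decomposition
`f = f₀⁴ + f₁⁴ g + f₂⁴ g² + f₃⁴ g³`, the class modulo squares of
`(f₁² f₃² + f₂⁴) g / (f₃⁴ g² + f₁⁴)`. If `[K : K²] = 2` and `g` is not a square then the
decomposition exists and is unique. (The value is `0` if there is no decomposition.) -/
def aInvariant {K : Type*} [Field K] (f g : K) : ModSquares K :=
  open Classical in
  if h : ∃ c : Fin 4 → K, f = c 0 ^ 4 + c 1 ^ 4 * g + c 2 ^ 4 * g ^ 2 + c 3 ^ 4 * g ^ 3 then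
    let c := h.choose
    QuotientAddGroup.mk ((c 1 ^ 2 * c 3 ^ 2 + c 2 ^ 4) * g / (c 3 ^ 4 * g ^ 2 + c 1 ^ 4))
  else 0

/-! ### Curves -/

namespace CharTwoCurve

/-- The sheaf `𝒪_X / 𝒪_X²` of abelian groups: the sheaf associated with the presheaf
`U ↦ 𝒪_X(U) / 𝒪_X(U)²`. -/
def raynaudSheaf (X : Scheme.{u}) : AbSheaf X :=
  (presheafToSheaf (Opens.grothendieckTopology X) AddCommGrpCat.{u}).obj
    (X.presheaf ⋙ modSquaresFunctor)

/-- The section of `𝒪_X / 𝒪_X²` over `U` defined by a section of `𝒪_X`. -/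
def raynaudSheaf.mk {X : Scheme.{u}} (U : X.Opens) (g : Γ(X, U)) :
    (raynaudSheaf X).obj.obj (op U) :=
  (toSheafify (Opens.grothendieckTopology X) (X.presheaf ⋙ modSquaresFunctor)).app (op U)
    (QuotientAddGroup.mk g : ModSquares Γ(X, U))

/-- The section `s` of `𝒪_X / 𝒪_X²` over `W` corresponds to the element `c` of `k(X) / k(X)²`:
locally on `W`, the section `s` is the class of a regular function whose class in `k(X) / k(X)²`
is `c`. -/
def Represents {X : Scheme.{u}} [IsIntegral X] {W : X.Opens}
    (s : (raynaudSheaf X).obj.obj (op W)) (c : ModSquares X.functionField) : Prop :=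
  ∀ x ∈ W, ∃ (V : X.Opens) (hV : V ≤ W) (_ : x ∈ V) (_ : Nonempty V) (g : Γ(X, V)),
    (raynaudSheaf X).obj.map (homOfLE hV).op s = raynaudSheaf.mk V g ∧
      (QuotientAddGroup.mk (X.germToFunctionField V g) : ModSquares X.functionField) = c

section

variable {k : Type u} [Field k] {X : Scheme.{u}} [IsIntegral X] (π : X ⟶ Spec (.of k))

/-- The embedding of the constants `k` into the function field of a `k`-scheme. -/
def constants : k →+* X.functionField :=
  haveI : Nonempty (⊤ : X.Opens) := ⟨⟨genericPoint X, trivial⟩⟩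
  (X.germToFunctionField ⊤).hom.comp
    (π.appTop.hom.comp (Scheme.ΓSpecIso (.of k)).inv.hom)

/-- The rational function `f`, viewed as a morphism to the projective line, is pseudo-tame at `x`.
Here `t` is the pullback along `f` of a uniformizer of the projective line at `f(x)`:
it is `f - c` if `f(x)` is the finite point `c`, and `1 / f` if `f(x)` is the point at infinity.
The order of vanishing of `0` is set to `0` in Mathlib, so that an odd order forces `t + h⁴ ≠ 0`;
in particular no constant function satisfies the condition. -/
def IsPseudoTameAt [LocallyOfFiniteType π] (f : X.functionField) (x : X) : Prop :=
  haveI : IsLocallyNoetherian X := LocallyOfFiniteType.isLocallyNoetherian π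
  ∃ t ∈ IsLocalRing.maximalIdeal (X.presheaf.stalk x),
    ((∃ c : k, algebraMap (X.presheaf.stalk x) X.functionField t = f - constants π c) ∨
      algebraMap (X.presheaf.stalk x) X.functionField t * f = 1) ∧
    ∃ h : X.presheaf.stalk x,
      Odd (Scheme.ord (algebraMap (X.presheaf.stalk x) X.functionField (t + h ^ 4)) x)

/-- `f` is pseudo-tame at every closed point of `U`. -/
def IsPseudoTameOn [LocallyOfFiniteType π] (f : X.functionField) (U : X.Opens) : Prop :=
  ∀ x ∈ U, IsClosed ({x} : Set X) → IsPseudoTameAt π f x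

/-- A covering of `X` by nonempty opens `U i`, with for each `i` a rational function `f i` that is
pseudo-tame on `U i`. -/
structure IsPseudoTameCovering [LocallyOfFiniteType π] {ι : Type u} (U : ι → X.Opens)
    (f : ι → X.functionField) : Prop where
  covers : iSup U = ⊤
  nonempty : ∀ i, (U i : Set X).Nonempty
  pseudoTame : ∀ i, IsPseudoTameOn π (f i) (U i)

end

/-- The cocycle `s` is the family `(a(f i, f j))`, where sections of `𝒪_X / 𝒪_X²` are identified
with elements of `k(X) / k(X)²`. -/
def IsObstructionCocycle {X : Scheme.{u}} [IsIntegral X] {ι : Type u} {U : ι → X.Opens}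
    (f : ι → X.functionField) (s : CechH1.OneCocycle (raynaudSheaf X) U) : Prop :=
  ∀ i j, Represents (s.sec i j) (aInvariant (f i) (f j))

end CharTwoCurve

end

/-!
The function field `K` of the curve satisfies `[K : K²] = 2`, so every `g ∉ K²` is a 2-basis of `K`
(`IsTwoBasis`) and there is a derivation `D = d / dg` with `D(a² + b² g) = b²`. Writing
`f = A² + B² g`, the invariant `a(f, g)` is the class modulo squares of
`g D(B) / B + (D(A) / B)² g` (`IsTwoBasis.aInvariant_eq`). The chain rule for `d / dg` and `d / dh`,
together with the fact that `w² h + w` is a square for every logarithmic derivative `w = B'/B` with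
respect to `h`, gives the cocycle relation `a(f, g) + a(g, h) = a(f, h)`
(`IsTwoBasis.aInvariant_add`). It also follows that `a(f, g)` does not change when a fourth power is
added to `f` or when `f` is replaced by `1 / f`.

If `f` is pseudo-tame at a closed point `x` with uniformizer `ϖ`, then by these invariances `f` may
be replaced by `ε ϖ ^ (2m + 1)` with a unit `ε = a² + b² ϖ`, where `a` is a unit. The formula for
`a(f, ϖ)` then has no pole, so `a(f, ϖ)` is regular modulo squares, and the cocycle relation gives
the same for `a(f, g)` if `g` is pseudo-tame at `x` as well
(`IsPseudoTameDVR.aInvariant_regular`). Since the local rings are integrally closed, a class in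
`K / K²` that is regular at all closed points of an open set corresponds to a unique section of
`𝒪_X / 𝒪_X²` (`Represents.unique`, `Represents.exists_of_regular`). This gives the Čech cocycle.

Smoothness enters through local coordinates (`exists_local_coordinate`): locally the differentials
have a basis `df`. Then `K` is finite and separable over `k(f)`, which shows that `f` is a 2-basis
of `K`; and for a closed point `y` the ring `𝒪_y / (f - f(y))` is local and unramified over `k`,
hence equal to `k`, so that `f - f(y)` is a uniformizer. In particular `f` is pseudo-tame near the
given point, and pseudo-tame coverings exist.

Two pseudo-tame coverings are subfamilies of their disjoint union. The cohomology class of a cocycle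
does not change when one passes to a subfamily that is still a covering, by naturality of the
connecting homomorphism (`CechH1.OneCocycle.cohomologyClass_reindex`), so both coverings define the
class attached to the union.
-/

noncomputable section

/-! ### Fields of characteristic two with a one-element 2-basis -/

section TwoBasis

variable {K : Type*} [Field K]

/-- The element `g` is a 2-basis of the field `K`: `(1, g)` is a basis of `K` over `K²`. -/
structure IsTwoBasis (g : K) : Prop where
  span : ∀ x : K, ∃ a b : K, x = a ^ 2 + b ^ 2 * g
  not_sq : ∀ a : K, a ^ 2 ≠ g

namespace IsTwoBasis

variable {f g : K}

lemma ne_zero (hf : IsTwoBasis f) : f ≠ 0 := fun h => hf.not_sq 0 (by rw [h]; ring)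

lemma exists_decomposition (hg : IsTwoBasis g) (hf : IsTwoBasis f) :
    ∃ A B : K, B ≠ 0 ∧ f = A ^ 2 + B ^ 2 * g := by
  obtain ⟨A, B, h⟩ := hg.span f
  refine ⟨A, B, ?_, h⟩
  rintro rfl
  exact hf.not_sq A (by rw [h]; ring)

end IsTwoBasis

variable [CharP K 2]

lemma ModSquares.mk_eq_mk_iff (x y : K) :
    (QuotientAddGroup.mk x : ModSquares K) = QuotientAddGroup.mk y ↔ ∃ r : K, r ^ 2 = y - x := by
  rw [QuotientAddGroup.eq, mem_squares_iff, neg_add_eq_sub]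

lemma Derivation.map_sq_of_charTwo (D : Derivation ℤ K K) (a : K) : D (a ^ 2) = 0 := by
  rw [D.leibniz_pow, two_nsmul, CharTwo.add_self_eq_zero]

namespace IsTwoBasis

variable {f g h : K}

lemma unique (hg : IsTwoBasis g) {a b c d : K} (H : a ^ 2 + b ^ 2 * g = c ^ 2 + d ^ 2 * g) :
    a = c ∧ b = d := by
  have hbd : b = d := by
    by_contra hne
    have h0 : b - d ≠ 0 := sub_ne_zero.mpr hne
    refine hg.not_sq ((c - a) / (b - d)) ?_
    rw [div_pow, div_eq_iff (pow_ne_zero 2 h0), sub_pow_char (p := 2) c a, sub_pow_char (p := 2) b d]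
    linear_combination -H
  subst hbd
  have h2 : (a - c) ^ 2 = 0 := by
    rw [sub_pow_char (p := 2) a c]
    linear_combination H
  exact ⟨sub_eq_zero.mp (pow_eq_zero_iff two_ne_zero |>.mp h2), rfl⟩

lemma of_not_sq (hg : IsTwoBasis g) (hf : ∀ a : K, a ^ 2 ≠ f) : IsTwoBasis f := by
  refine ⟨fun x => ?_, hf⟩
  obtain ⟨p, q, hpq⟩ := hg.span f
  have hq : q ≠ 0 := by
    rintro rfl
    exact hf p (by rw [hpq]; ring)
  obtain ⟨a, b, hx⟩ := hg.span x
  refine ⟨a - b * p / q, b / q, ?_⟩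
  rw [sub_pow_char (p := 2) a _, hx, hpq]
  field_simp
  ring

/-- If `g` is a 2-basis of `K`, then `a² + b² g ↦ b²` is a derivation of `K`; it is the
derivation `d / dg`. -/
lemma exists_derivation (hg : IsTwoBasis g) : ∃ D : Derivation ℤ K K, D g = 1 := by
  choose p q hpq using hg.span
  have key : ∀ {x a b : K}, x = a ^ 2 + b ^ 2 * g → q x ^ 2 = b ^ 2 := by
    intro x a b hx
    rw [(hg.unique ((hpq x).symm.trans hx)).2]
  let φ : K →+ K :=
    { toFun := fun x => q x ^ 2
      map_zero' := by
        rw [key (x := 0) (a := 0) (b := 0) (by ring)]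
        ring
      map_add' := fun x y => by
        rw [key (x := x + y) (a := p x + p y) (b := q x + q y), CharTwo.add_sq]
        rw [CharTwo.add_sq, CharTwo.add_sq]
        linear_combination hpq x + hpq y }
  refine ⟨Derivation.mk' φ.toIntLinearMap fun x y => ?_, ?_⟩
  · change q (x * y) ^ 2 = x • q y ^ 2 + y • q x ^ 2
    rw [key (x := x * y) (a := p x * p y + q x * q y * g) (b := p x * q y + q x * p y),
      CharTwo.add_sq, smul_eq_mul, smul_eq_mul]
    · linear_combination -(q y ^ 2) * hpq x - q x ^ 2 * hpq y -
        q x ^ 2 * q y ^ 2 * g * CharTwo.two_eq_zero (R := K)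
    · rw [CharTwo.add_sq, CharTwo.add_sq]
      linear_combination y * hpq x + (p x ^ 2 + q x ^ 2 * g) * hpq y
  · change q g ^ 2 = 1
    rw [key (x := g) (a := 0) (b := 1) (by ring), one_pow]

lemma exists_quartic (hg : IsTwoBasis g) (f : K) : ∃ c : Fin 4 → K,
    f = c 0 ^ 4 + c 1 ^ 4 * g + c 2 ^ 4 * g ^ 2 + c 3 ^ 4 * g ^ 3 := by
  obtain ⟨A, B, rfl⟩ := hg.span f
  obtain ⟨c₀, c₂, rfl⟩ := hg.span A
  obtain ⟨c₁, c₃, rfl⟩ := hg.span B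
  refine ⟨![c₀, c₁, c₂, c₃], ?_⟩
  rw [CharTwo.add_sq, CharTwo.add_sq]
  simp only [Matrix.cons_val]
  ring

/-- In terms of the derivation `D = d / dg` and of the decomposition `f = A² + B² g`, the invariant
`a(f, g)` is the class of `g D(B) / B + (D(A) / B)² g`. -/
lemma aInvariant_eq (hg : IsTwoBasis g) {D : Derivation ℤ K K} (hD : D g = 1) {A B : K}
    (hB : B ≠ 0) (hf : f = A ^ 2 + B ^ 2 * g) :
    aInvariant f g = QuotientAddGroup.mk (g * D B / B + (D A / B) ^ 2 * g) := by
  have hex := hg.exists_quartic f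
  rw [aInvariant, dif_pos hex]
  have hc := hex.choose_spec
  set c := hex.choose
  obtain ⟨rfl, rfl⟩ := hg.unique (a := A) (b := B) (c := c 0 ^ 2 + c 2 ^ 2 * g)
    (d := c 1 ^ 2 + c 3 ^ 2 * g) (by
      rw [← hf, CharTwo.add_sq, CharTwo.add_sq]
      linear_combination hc)
  have h0 : D (c 0 ^ 2 + c 2 ^ 2 * g) = c 2 ^ 2 := by
    simp [D.map_sq_of_charTwo, hD]
  have h1 : D (c 1 ^ 2 + c 3 ^ 2 * g) = c 3 ^ 2 := by
    simp [D.map_sq_of_charTwo, hD]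
  rw [h0, h1, ModSquares.mk_eq_mk_iff]
  -- Both representatives have the denominator `B²`, and they differ by `(c₃² g / B)²`.
  refine ⟨c 3 ^ 2 * g / (c 1 ^ 2 + c 3 ^ 2 * g), ?_⟩
  have hden : c 3 ^ 4 * g ^ 2 + c 1 ^ 4 = (c 1 ^ 2 + c 3 ^ 2 * g) ^ 2 := by
    rw [CharTwo.add_sq]
    ring
  rw [hden]
  field_simp
  ring

/-- The cocycle relation. It comes from the chain rule for `d / dg` and from the fact that
`w² h + w` is a square for every logarithmic derivative `w` with respect to `h`. -/
lemma aInvariant_add (hf : IsTwoBasis f) (hg : IsTwoBasis g) (hh : IsTwoBasis h) :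
    aInvariant f g + aInvariant g h = aInvariant f h := by
  obtain ⟨A, B, hB, hfg⟩ := hg.exists_decomposition hf
  obtain ⟨C, E, hE, hgh⟩ := hh.exists_decomposition hg
  obtain ⟨D, hD⟩ := hh.exists_derivation
  have hDg : D g = E ^ 2 := by
    rw [hgh]
    simp [D.map_sq_of_charTwo, hD]
  have hfh : f = (A + B * C) ^ 2 + (B * E) ^ 2 * h := by
    rw [CharTwo.add_sq, hfg, hgh]
    ring
  obtain ⟨p, q, hpq⟩ := hh.span B
  have hDB : D B = q ^ 2 := by
    rw [hpq]
    simp [D.map_sq_of_charTwo, hD]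
  rw [hg.aInvariant_eq (D := (E ^ 2)⁻¹ • D) (by simp [hDg, hE]) hB hfg,
    hh.aInvariant_eq hD hE hgh, hh.aInvariant_eq hD (mul_ne_zero hB hE) hfh,
    ← QuotientAddGroup.mk_add, ModSquares.mk_eq_mk_iff]
  simp only [Derivation.smul_apply, D.leibniz, map_add, smul_eq_mul, hDB]
  -- The first term is the square root of `(w² h + w) (C / E)²` for `w = D(B) / B`, and the second one
  -- comes from the part `C²` of `g = C² + E² h` in `(D(A) / B)² g`.
  refine ⟨C * q * p / (B * E) + C * D A / (B * E ^ 2), ?_⟩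
  have hp : p ^ 2 = B - q ^ 2 * h := by rw [hpq]; ring
  simp only [CharTwo.add_sq, div_pow, mul_pow, hp, hgh]
  field_simp
  linear_combination (C ^ 2 * q ^ 2 * B * E ^ 2 - C ^ 2 * q ^ 4 * h * E ^ 2 + C ^ 2 * D A ^ 2) *
    CharTwo.two_eq_zero (R := K)

lemma aInvariant_self (hg : IsTwoBasis g) : aInvariant g g = 0 := by
  simpa using hg.aInvariant_add hg hg

lemma aInvariant_comm (hf : IsTwoBasis f) (hg : IsTwoBasis g) :
    aInvariant f g = aInvariant g f := by
  have hx : ∀ x : ModSquares K, x + x = 0 := by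
    intro x
    induction x using QuotientAddGroup.induction_on with
    | H x => rw [← QuotientAddGroup.mk_add, CharTwo.add_self_eq_zero, QuotientAddGroup.mk_zero]
  have h := hf.aInvariant_add hg hf
  rw [hf.aInvariant_self] at h
  rw [eq_neg_of_add_eq_zero_left h]
  exact neg_eq_of_add_eq_zero_left (hx _)

lemma add_fourth_power (hf : IsTwoBasis f) (d : K) : IsTwoBasis (f + d ^ 4) := by
  refine hf.of_not_sq fun a ha => hf.not_sq (a + d ^ 2) ?_
  rw [CharTwo.add_sq, ha]
  linear_combination d ^ 4 * CharTwo.two_eq_zero (R := K)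

lemma inv (hf : IsTwoBasis f) : IsTwoBasis f⁻¹ := by
  refine hf.of_not_sq fun a ha => hf.not_sq a⁻¹ ?_
  rw [inv_pow, ha, inv_inv]

lemma aInvariant_add_fourth_power (hf : IsTwoBasis f) (hg : IsTwoBasis g) (d : K) :
    aInvariant (f + d ^ 4) g = aInvariant f g := by
  obtain ⟨A, B, hB, hfg⟩ := hg.exists_decomposition hf
  obtain ⟨D, hD⟩ := hg.exists_derivation
  rw [hg.aInvariant_eq hD hB hfg, hg.aInvariant_eq (A := A + d ^ 2) hD hB]
  · rw [map_add, D.map_sq_of_charTwo, add_zero]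
  · rw [CharTwo.add_sq, hfg]
    ring

lemma aInvariant_inv (hf : IsTwoBasis f) (hg : IsTwoBasis g) :
    aInvariant f⁻¹ g = aInvariant f g := by
  obtain ⟨D, hD⟩ := hf.exists_derivation
  have h0 := hf.ne_zero
  rw [← hf.inv.aInvariant_add hf hg,
    hf.aInvariant_eq (f := f⁻¹) (A := 0) (B := f⁻¹) hD (inv_ne_zero h0) (by field_simp; ring),
    add_eq_right, ← QuotientAddGroup.mk_zero, ModSquares.mk_eq_mk_iff]
  refine ⟨1, ?_⟩
  rw [D.leibniz_inv, hD]
  simp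
  field_simp

end IsTwoBasis
end TwoBasis

/-! ### Regularity of the invariant in a discrete valuation ring -/

section Regularity

/-- The valuations of `a²` and `b² p` have different parity, so that neither can be smaller than the
valuation of the sum. -/
lemma Prime.pow_dvd_of_sq_add_sq_mul_eq {R : Type*} [CommRing R] [IsDomain R] {p : R}
    (hp : Prime p) (n : ℕ) {a b y : R} (h : a ^ 2 + b ^ 2 * p = p ^ (2 * n) * y) :
    p ^ n ∣ a ∧ p ^ n ∣ b := by
  induction n generalizing a b with
  | zero => simp
  | succ n ih =>
    obtain ⟨a, rfl⟩ := hp.dvd_of_dvd_pow (a := a) (n := 2)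
      ⟨p ^ (2 * n + 1) * y - b ^ 2, by linear_combination h⟩
    have h' : p * a ^ 2 + b ^ 2 = p ^ (2 * n + 1) * y := by
      refine mul_left_cancel₀ hp.ne_zero ?_
      linear_combination h
    obtain ⟨b, rfl⟩ := hp.dvd_of_dvd_pow (a := b) (n := 2)
      ⟨p ^ (2 * n) * y - a ^ 2, by linear_combination h'⟩
    obtain ⟨⟨a, rfl⟩, ⟨b, rfl⟩⟩ := ih (a := a) (b := b) (by
      refine mul_left_cancel₀ hp.ne_zero ?_
      linear_combination h')
    exact ⟨⟨a, by ring⟩, ⟨b, by ring⟩⟩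

variable {R K : Type*} [CommRing R] [IsDomain R] [IsDiscreteValuationRing R] [Field K]
  [Algebra R K] [IsFractionRing R K]

/-- The coordinates of an element of `R` in the 2-basis of `K` given by a uniformizer are in
`R`. -/
lemma Irreducible.exists_eq_of_sq_add_sq_mul_eq {ϖ : R} (hϖ : Irreducible ϖ) {a b : K} {y : R}
    (h : algebraMap R K y = a ^ 2 + b ^ 2 * algebraMap R K ϖ) :
    ∃ a' b' : R, algebraMap R K a' = a ∧ algebraMap R K b' = b := by
  obtain ⟨d, hd⟩ := IsLocalization.exist_integer_multiples_of_finset (nonZeroDivisors R)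
    (S := K) (open Classical in {a, b})
  obtain ⟨α, hα⟩ := hd a (by simp)
  obtain ⟨β, hβ⟩ := hd b (by simp)
  obtain ⟨n, ε, hn⟩ := IsDiscreteValuationRing.eq_unit_mul_pow_irreducible
    (nonZeroDivisors.ne_zero d.2) hϖ
  have hinj := IsFractionRing.injective R K
  have hd0 : algebraMap R K (d : R) ≠ 0 := by
    rw [Ne, map_eq_zero_iff _ hinj]
    exact nonZeroDivisors.ne_zero d.2
  rw [Algebra.smul_def] at hα hβ
  have h1 : α ^ 2 + β ^ 2 * ϖ = ϖ ^ (2 * n) * (ε ^ 2 * y) := by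
    apply hinj
    have : ϖ ^ (2 * n) * ((ε : R) ^ 2 * y) = (d : R) ^ 2 * y := by rw [hn]; ring
    rw [this]
    simp only [map_add, map_mul, map_pow, hα, hβ, h]
    ring
  obtain ⟨⟨a', ha⟩, ⟨b', hb⟩⟩ := hϖ.prime.pow_dvd_of_sq_add_sq_mul_eq n h1
  have hε : ϖ ^ n = (d : R) * (ε⁻¹ : Rˣ) := by
    rw [hn, mul_right_comm, Units.mul_inv, one_mul]
  refine ⟨(ε⁻¹ : Rˣ) * a', (ε⁻¹ : Rˣ) * b', mul_left_cancel₀ hd0 ?_, mul_left_cancel₀ hd0 ?_⟩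
  · rw [← hα, ha, ← map_mul, hε]
    ring_nf
  · rw [← hβ, hb, ← map_mul, hε]
    ring_nf

variable [CharP K 2]

lemma IsTwoBasis.of_irreducible {z : K} (hz : IsTwoBasis z) {ϖ : R} (hϖ : Irreducible ϖ) :
    IsTwoBasis (algebraMap R K ϖ) := by
  refine hz.of_not_sq fun a ha => ?_
  have hint : IsIntegral R (a ^ 2) := ha ▸ isIntegral_algebraMap
  obtain ⟨r, rfl⟩ := IsIntegrallyClosed.exists_algebraMap_eq_of_isIntegral_pow two_pos hint
  rw [← map_pow] at ha
  exact hϖ.not_isSquare ⟨r, by rw [← IsFractionRing.injective R K ha, sq]⟩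

variable (R) in
/-- The element `f` of the fraction field `K` of the discrete valuation ring `R` is pseudo-tame: up
to a fourth power, `f` or `1 / f` is an element of `R` of odd valuation. The fourth power is taken in
`K`, which leaves room for subtracting from `f` a constant that is a fourth power. -/
def IsPseudoTameDVR (f : K) : Prop :=
  ∃ (ϖ : R) (ε : Rˣ) (m : ℕ) (d : K), Irreducible ϖ ∧
    (algebraMap R K (ε * ϖ ^ (2 * m + 1)) = f + d ^ 4 ∨
      (algebraMap R K (ε * ϖ ^ (2 * m + 1)) + d ^ 4) * f = 1)

/-- Regularity of `a(f, ϖ)` for `f = ε ϖ ^ (2m + 1)`. Write `ε = a² + b² ϖ` with `a, b ∈ R`; then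
`f = A² + B² ϖ` with `A = ϖ ^ (m + 1) b` and `B = ϖ ^ m a`. Here `a` is a unit, and the derivation
`d / dϖ` maps `a` and `b` to `R`, so that `D(A) / B` and `ϖ D(B) / B` are in `R`. -/
lemma IsTwoBasis.aInvariant_unit_mul_pow_odd {ϖ : R} (hϖ : Irreducible ϖ)
    (hz : IsTwoBasis (algebraMap R K ϖ)) (ε : Rˣ) (m : ℕ) :
    IsTwoBasis (algebraMap R K (ε * ϖ ^ (2 * m + 1))) ∧ ∃ r : R,
      aInvariant (algebraMap R K (ε * ϖ ^ (2 * m + 1))) (algebraMap R K ϖ) =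
        QuotientAddGroup.mk (algebraMap R K r) := by
  have hinj := IsFractionRing.injective R K
  obtain ⟨_, _, hab⟩ := hz.span (algebraMap R K (ε : R))
  obtain ⟨a, b, rfl, rfl⟩ := hϖ.exists_eq_of_sq_add_sq_mul_eq hab
  obtain ⟨_, _, ha⟩ := hz.span (algebraMap R K a)
  obtain ⟨a₀, a₁, rfl, rfl⟩ := hϖ.exists_eq_of_sq_add_sq_mul_eq ha
  obtain ⟨_, _, hb⟩ := hz.span (algebraMap R K b)
  obtain ⟨b₀, b₁, rfl, rfl⟩ := hϖ.exists_eq_of_sq_add_sq_mul_eq hb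
  -- Otherwise `ε = a² + b² ϖ` would be in the maximal ideal.
  have hau : IsUnit a := by
    by_contra hna
    have h1 : (ε : R) = a ^ 2 + b ^ 2 * ϖ := by
      apply hinj
      simpa using hab
    have h2 : (ε : R) ∈ IsLocalRing.maximalIdeal R := by
      rw [h1]
      exact add_mem (Ideal.pow_mem_of_mem _ ((IsLocalRing.mem_maximalIdeal _).mpr hna) 2 two_pos)
        (Ideal.mul_mem_left _ _ ((IsLocalRing.mem_maximalIdeal _).mpr hϖ.not_isUnit))
    exact (IsLocalRing.mem_maximalIdeal _).mp h2 ε.isUnit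
  obtain ⟨a, rfl⟩ := hau
  have hϖ0 : algebraMap R K ϖ ≠ 0 := hz.ne_zero
  have ha0 : algebraMap R K (a : R) ≠ 0 := (a.isUnit.map (algebraMap R K)).ne_zero
  have hB : algebraMap R K (ϖ ^ m * a) ≠ 0 := by
    rw [map_mul, map_pow]
    exact mul_ne_zero (pow_ne_zero _ hϖ0) ha0
  have hu : algebraMap R K (ε * ϖ ^ (2 * m + 1)) =
      algebraMap R K (ϖ ^ (m + 1) * b) ^ 2 + algebraMap R K (ϖ ^ m * a) ^ 2 * algebraMap R K ϖ := by
    rw [map_mul, hab]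
    simp only [map_mul, map_pow]
    ring
  refine ⟨hz.of_not_sq fun x hx => hB ?_, ?_⟩
  · exact (hz.unique (a := x) (b := 0) ((by rw [hx]; ring : _ = _).trans hu)).2.symm
  obtain ⟨D, hD⟩ := hz.exists_derivation
  have hDa : D (algebraMap R K a) = algebraMap R K a₁ ^ 2 := by
    rw [ha, map_add, D.leibniz, D.map_sq_of_charTwo, D.map_sq_of_charTwo, hD]
    simp
  have hDb : D (algebraMap R K b) = algebraMap R K b₁ ^ 2 := by
    rw [hb, map_add, D.leibniz, D.map_sq_of_charTwo, D.map_sq_of_charTwo, hD]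
    simp
  have hDpow : ∀ n : ℕ, algebraMap R K ϖ * D (algebraMap R K ϖ ^ n) =
      n * algebraMap R K ϖ ^ n := by
    intro n
    rw [D.leibniz_pow, hD]
    cases n with
    | zero => simp
    | succ n =>
      simp
      ring
  have hainv : algebraMap R K ((a⁻¹ : Rˣ) : R) = (algebraMap R K a)⁻¹ := by
    refine eq_inv_of_mul_eq_one_left ?_
    rw [← map_mul, Units.inv_mul, map_one]
  rw [hz.aInvariant_eq hD hB hu]
  refine ⟨m + ϖ * a₁ ^ 2 * (a⁻¹ : Rˣ) +
    (((m + 1 : ℕ) * b + ϖ * b₁ ^ 2) * (a⁻¹ : Rˣ)) ^ 2 * ϖ, ?_⟩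
  congr 1
  have e1 : algebraMap R K ϖ * D (algebraMap R K (ϖ ^ m * a)) =
      (m * algebraMap R K a + algebraMap R K ϖ * algebraMap R K a₁ ^ 2) *
        algebraMap R K ϖ ^ m := by
    rw [map_mul, map_pow, D.leibniz, hDa, smul_eq_mul, smul_eq_mul]
    linear_combination algebraMap R K a * hDpow m
  have e2 : D (algebraMap R K (ϖ ^ (m + 1) * b)) =
      ((m + 1 : ℕ) * algebraMap R K b + algebraMap R K ϖ * algebraMap R K b₁ ^ 2) *
        algebraMap R K ϖ ^ m := by
    refine mul_left_cancel₀ hϖ0 ?_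
    rw [map_mul, map_pow, D.leibniz, hDb, smul_eq_mul, smul_eq_mul]
    linear_combination algebraMap R K b * hDpow (m + 1)
  rw [e1, e2]
  simp only [map_add, map_mul, map_pow, map_natCast, hainv]
  field_simp

lemma IsPseudoTameDVR.isTwoBasis_and_regular {z : K} (hz : IsTwoBasis z) {f : K}
    (hf : IsPseudoTameDVR R f) : IsTwoBasis f ∧ ∃ ϖ : R, Irreducible ϖ ∧ ∃ r : R,
      aInvariant f (algebraMap R K ϖ) = QuotientAddGroup.mk (algebraMap R K r) := by
  obtain ⟨ϖ, ε, m, d, hϖ, h⟩ := hf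
  have hϖ' := hz.of_irreducible hϖ
  obtain ⟨hu, r, hr⟩ := hϖ'.aInvariant_unit_mul_pow_odd hϖ ε m
  set u := algebraMap R K (ε * ϖ ^ (2 * m + 1))
  obtain h | h := h
  · have hfu : f = u + d ^ 4 := by
      rw [h, add_assoc, CharTwo.add_self_eq_zero, add_zero]
    rw [hfu]
    refine ⟨hu.add_fourth_power d, ϖ, hϖ, r, ?_⟩
    rw [hu.aInvariant_add_fourth_power hϖ', hr]
  · rw [eq_inv_of_mul_eq_one_right h]
    have hud := hu.add_fourth_power d
    refine ⟨hud.inv, ϖ, hϖ, r, ?_⟩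
    rw [hud.aInvariant_inv hϖ', hu.aInvariant_add_fourth_power hϖ', hr]

lemma IsTwoBasis.aInvariant_regular_irreducible {z : K} (hz : IsTwoBasis z) {ϖ ϖ' : R}
    (hϖ : Irreducible ϖ) (hϖ' : Irreducible ϖ') : ∃ r : R,
      aInvariant (algebraMap R K ϖ) (algebraMap R K ϖ') =
        QuotientAddGroup.mk (algebraMap R K r) := by
  obtain ⟨ε, rfl⟩ := IsDiscreteValuationRing.associated_of_irreducible R hϖ' hϖ
  simpa [mul_comm] using ((hz.of_irreducible hϖ').aInvariant_unit_mul_pow_odd hϖ' ε 0).2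

/-- If `f` and `g` are both pseudo-tame, then `a(f, g)` is regular modulo squares: it is the sum
of `a(f, ϖ)` and `a(ϖ, g)` for a uniformizer `ϖ`. -/
lemma IsPseudoTameDVR.aInvariant_regular {z : K} (hz : IsTwoBasis z) {f g : K}
    (hf : IsPseudoTameDVR R f) (hg : IsPseudoTameDVR R g) :
    ∃ r : R, aInvariant f g = QuotientAddGroup.mk (algebraMap R K r) := by
  obtain ⟨hf, ϖ, hϖ, r, hr⟩ := hf.isTwoBasis_and_regular hz
  obtain ⟨hg, ϖ', hϖ', s, hs⟩ := hg.isTwoBasis_and_regular hz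
  obtain ⟨q, hq⟩ := hz.aInvariant_regular_irreducible hϖ hϖ'
  have h1 := hz.of_irreducible hϖ
  have h2 := hz.of_irreducible hϖ'
  refine ⟨r + q + s, ?_⟩
  rw [← hf.aInvariant_add h2 hg, ← hf.aInvariant_add h1 h2, h2.aInvariant_comm hg, hr, hq, hs]
  simp

end Regularity

/-! ### Refinements of coverings and cohomology classes -/

namespace CechH1

variable {T : TopCat.{u}} {F : AbSheaf T} {ι κ : Type u} {U : κ → Opens T}

/-- The cocycle for the subfamily `U ∘ r` deduced from a cocycle for the family `U`. -/
def OneCocycle.reindex (s : OneCocycle F U) (r : ι → κ) : OneCocycle F (fun i => U (r i)) where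
  sec i j := s.sec (r i) (r j)
  cocycle i j k := s.cocycle (r i) (r j) (r k)

variable (F U) in
/-- The map of sheaves of 0-cochains that forgets the components outside of the subfamily
`U ∘ r`. -/
def reindexCochain (r : ι → κ) : cochainSheaf F U ⟶ cochainSheaf F (fun i => U (r i)) where
  hom :=
    { app := fun V => AddCommGrpCat.ofHom
        { toFun := fun t i => (t : ∀ i, F.obj.obj (op (V.unop ⊓ U i))) (r i)
          map_zero' := rfl
          map_add' := fun _ _ => rfl }
      naturality := fun _ _ _ => rfl }

variable (F U) in
/-- The map of short exact sequences `0 ⟶ F ⟶ C⁰ ⟶ C⁰ / F ⟶ 0` that is induced by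
`reindexCochain`. -/
def reindexSequence (r : ι → κ) :
    cochainSequence F (U := U) ⟶ cochainSequence F (U := fun i => U (r i)) where
  τ₁ := 𝟙 F
  τ₂ := reindexCochain F U r
  τ₃ := Limits.cokernel.desc _
    (reindexCochain F U r ≫ Limits.cokernel.π (toCochain F (fun i => U (r i)))) (by
      have : toCochain F U ≫ reindexCochain F U r = toCochain F (fun i => U (r i)) := rfl
      rw [← Category.assoc, this, Limits.cokernel.condition])
  comm₁₂ := rfl
  comm₂₃ := (Limits.cokernel.π_desc _ _ _).symm

/-- Passing to a subfamily that still is a covering does not change the cohomology class of a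
cocycle. -/
lemma OneCocycle.cohomologyClass_reindex (s : OneCocycle F U) (r : ι → κ) (hU : iSup U = ⊤)
    (hr : iSup (fun i => U (r i)) = ⊤) :
    (s.reindex r).cohomologyClass hr = s.cohomologyClass hU := by
  have hq : ((s.reindex r).existsUnique_glue hr).choose =
      (reindexSequence F U r).τ₃.hom.app (op ⊤) (s.existsUnique_glue hU).choose := by
    refine ((s.reindex r).existsUnique_glue hr).unique
      ((s.reindex r).existsUnique_glue hr).choose_spec.1 fun j => ?_
    have h1 := (s.existsUnique_glue hU).choose_spec.1 (r j)
    rw [← NatTrans.naturality_apply, h1]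
    have h2 := congrArg (fun φ => φ.hom.app (op (U (r j)))) (reindexSequence F U r).comm₂₃
    exact (congrArg (fun φ => φ (s.lift (r j))) (congrArg AddCommGrpCat.Hom.hom h2)).symm
  have h3 := (cochainSequence_shortExact F hU).extClass_naturality
    (cochainSequence_shortExact F hr) (reindexSequence F U r)
  have h4 : (Abelian.Ext.mk₀ (reindexSequence F U r).τ₁) = Abelian.Ext.mk₀ (𝟙 F) := rfl
  rw [h4, Abelian.Ext.comp_mk₀_id] at h3
  unfold OneCocycle.cohomologyClass
  rw [hq, ← Sheaf.H.equiv₀_symm_naturality, h3]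
  exact Abelian.Ext.comp_assoc _ _ _ (add_zero 0) (zero_add 1) (by simp)

end CechH1

/-! ### Sections of `𝒪_X / 𝒪_X²` and elements of `k(X) / k(X)²` -/

/-- In a Jacobson space a family of open sets that contains all closed points of an open set `W`
covers `W`, because each point of `W` specializes to a closed point in `W`. -/
lemma exists_closed_point_specializes {X : Type*} [TopologicalSpace X] [JacobsonSpace X]
    {W : Set X} (hW : IsOpen W) {z : X} (hz : z ∈ W) :
    ∃ x ∈ W, IsClosed ({x} : Set X) ∧ z ⤳ x := by
  have hS : IsLocallyClosed (W ∩ closure {z}) := hW.isLocallyClosed.inter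
    isClosed_closure.isLocallyClosed
  have hne : (W ∩ closure {z} ∩ closedPoints X).Nonempty := by
    rw [← closure_nonempty_iff, JacobsonSpace.closure_inter_closedPoints_eq_closure hS,
      closure_nonempty_iff]
    exact ⟨z, hz, subset_closure rfl⟩
  obtain ⟨x, ⟨hxW, hxz⟩, hx⟩ := hne
  exact ⟨x, hxW, hx, specializes_iff_mem_closure.mpr hxz⟩

namespace CharTwoCurve

variable {X : Scheme.{u}}

/-- Restriction of sections of `𝒪_X / 𝒪_X²`. -/
abbrev raynaudSheaf.res {V W : X.Opens} (h : V ≤ W) (s : (raynaudSheaf X).obj.obj (op W)) :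
    (raynaudSheaf X).obj.obj (op V) :=
  (raynaudSheaf X).obj.map (homOfLE h).op s

lemma raynaudSheaf.res_mk {V W : X.Opens} (h : V ≤ W) (g : Γ(X, W)) :
    raynaudSheaf.res h (raynaudSheaf.mk W g) =
      raynaudSheaf.mk V (X.presheaf.map (homOfLE h).op g) :=
  (NatTrans.naturality_apply (toSheafify (Opens.grothendieckTopology X)
    (X.presheaf ⋙ modSquaresFunctor)) (homOfLE h).op
      (QuotientAddGroup.mk g : ModSquares Γ(X, W))).symm

lemma raynaudSheaf.mk_add {W : X.Opens} (g g' : Γ(X, W)) :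
    raynaudSheaf.mk W (g + g') = raynaudSheaf.mk W g + raynaudSheaf.mk W g' :=
  map_add ((toSheafify (Opens.grothendieckTopology X)
    (X.presheaf ⋙ modSquaresFunctor)).app (op W)).hom
      (QuotientAddGroup.mk g : ModSquares Γ(X, W)) (QuotientAddGroup.mk g')

lemma raynaudSheaf.mk_eq_of_sub_eq_sq {W : X.Opens} {g g' : Γ(X, W)} (r : Γ(X, W))
    (h : r ^ 2 = g' - g) : raynaudSheaf.mk W g = raynaudSheaf.mk W g' := by
  have : (QuotientAddGroup.mk g : ModSquares Γ(X, W)) = QuotientAddGroup.mk g' := by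
    rw [QuotientAddGroup.eq, neg_add_eq_sub, ← h]
    exact AddSubgroup.subset_closure ⟨r, rfl⟩
  rw [raynaudSheaf.mk, raynaudSheaf.mk, this]

lemma raynaudSheaf.res_res {U V W : X.Opens} (h : U ≤ V) (h' : V ≤ W)
    (s : (raynaudSheaf X).obj.obj (op W)) :
    res h (res h' s) = res (h.trans h') s :=
  CechH1.res_res (raynaudSheaf X) h h' s

variable [IsIntegral X]

lemma germToFunctionField_res {V W : X.Opens} (h : V ≤ W) [Nonempty V] [Nonempty W]
    (g : Γ(X, W)) :
    X.germToFunctionField V (X.presheaf.map (homOfLE h).op g) = X.germToFunctionField W g :=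
  X.presheaf.germ_res_apply (homOfLE h) _ _ g

namespace Represents

variable {V W : X.Opens} {c c' : ModSquares X.functionField}
  {s s' : (raynaudSheaf X).obj.obj (op W)}

lemma res (hs : Represents s c) (h : V ≤ W) : Represents (raynaudSheaf.res h s) c := by
  intro x hx
  obtain ⟨Z, hZ, hxZ, hne, g, hg, hgc⟩ := hs x (h hx)
  have hne' : Nonempty (Z ⊓ V : X.Opens) := ⟨⟨x, hxZ, hx⟩⟩
  refine ⟨Z ⊓ V, inf_le_right, ⟨hxZ, hx⟩, hne', X.presheaf.map (homOfLE inf_le_left).op g, ?_, ?_⟩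
  · rw [← raynaudSheaf.res_mk, ← hg]
    exact (raynaudSheaf.res_res _ _ s).trans (raynaudSheaf.res_res _ _ s).symm
  · rw [germToFunctionField_res]
    exact hgc

lemma add (hs : Represents s c) (hs' : Represents s' c') : Represents (s + s') (c + c') := by
  intro x hx
  obtain ⟨Z, hZ, hxZ, hne, g, hg, hgc⟩ := hs x hx
  obtain ⟨Z', hZ', hxZ', hne', g', hg', hgc'⟩ := hs' x hx
  have hne'' : Nonempty (Z ⊓ Z' : X.Opens) := ⟨⟨x, hxZ, hxZ'⟩⟩
  refine ⟨Z ⊓ Z', inf_le_left.trans hZ, ⟨hxZ, hxZ'⟩, hne'',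
    X.presheaf.map (homOfLE inf_le_left).op g + X.presheaf.map (homOfLE inf_le_right).op g', ?_, ?_⟩
  · rw [raynaudSheaf.mk_add, ← raynaudSheaf.res_mk, ← raynaudSheaf.res_mk, ← hg, ← hg', map_add]
    congr 1
    · exact (raynaudSheaf.res_res _ _ s).symm
    · exact (raynaudSheaf.res_res _ _ s').symm
  · rw [map_add, germToFunctionField_res, germToFunctionField_res, QuotientAddGroup.mk_add, hgc,
      hgc']

lemma mk [Nonempty V] (g : Γ(X, V)) :
    Represents (raynaudSheaf.mk V g) (QuotientAddGroup.mk (X.germToFunctionField V g)) := by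
  intro x hx
  refine ⟨V, le_rfl, hx, inferInstance, g, ?_, rfl⟩
  change (raynaudSheaf X).obj.map (𝟙 _) _ = _
  simp

variable [CharP X.functionField 2]
  (hX : ∀ x : X, IsClosed ({x} : Set X) → IsIntegrallyClosed (X.presheaf.stalk x))

include hX in
/-- Sections of `𝒪_X / 𝒪_X²` that correspond to the same element agree near each closed point `x`:
if the difference of two elements of `𝒪_{X,x}` is the square of a rational function then that
function is in `𝒪_{X,x}`, because this ring is integrally closed. -/
lemma exists_res_eq (hs : Represents s c) (hs' : Represents s' c) {x : X} (hxW : x ∈ W)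
    (hx : IsClosed ({x} : Set X)) : ∃ (V : X.Opens) (hV : V ≤ W), x ∈ V ∧
      raynaudSheaf.res hV s = raynaudSheaf.res hV s' := by
  obtain ⟨Z, hZ, hxZ, hne, g, hg, hgc⟩ := hs x hxW
  obtain ⟨Z', hZ', hxZ', hne', g', hg', hgc'⟩ := hs' x hxW
  have := hX x hx
  rw [← hgc', ModSquares.mk_eq_mk_iff] at hgc
  obtain ⟨r, hr⟩ := hgc
  rw [← Scheme.algebraMap_germ_eq_germToFunctionField X hxZ,
    ← Scheme.algebraMap_germ_eq_germToFunctionField X hxZ', ← map_sub] at hr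
  have hint : IsIntegral (X.presheaf.stalk x) (r ^ 2) := hr ▸ isIntegral_algebraMap
  obtain ⟨ρ, rfl⟩ := IsIntegrallyClosed.exists_algebraMap_eq_of_isIntegral_pow two_pos hint
  rw [← map_pow] at hr
  have hρ := IsFractionRing.injective (X.presheaf.stalk x) X.functionField hr
  obtain ⟨V, hxV, ρ, rfl⟩ := X.presheaf.exists_germ_eq ρ
  have h1 : Z ⊓ Z' ⊓ V ≤ Z := inf_le_left.trans inf_le_left
  have h2 : Z ⊓ Z' ⊓ V ≤ Z' := inf_le_left.trans inf_le_right
  have h3 : Z ⊓ Z' ⊓ V ≤ V := inf_le_right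
  have hxI : x ∈ Z ⊓ Z' ⊓ V := ⟨⟨hxZ, hxZ'⟩, hxV⟩
  refine ⟨Z ⊓ Z' ⊓ V, h1.trans hZ, hxI, ?_⟩
  rw [← raynaudSheaf.res_res h1 hZ, ← raynaudSheaf.res_res h2 hZ']
  change raynaudSheaf.res h1 ((raynaudSheaf X).obj.map (homOfLE hZ).op s) =
    raynaudSheaf.res h2 ((raynaudSheaf X).obj.map (homOfLE hZ').op s')
  rw [hg, hg', raynaudSheaf.res_mk, raynaudSheaf.res_mk]
  refine raynaudSheaf.mk_eq_of_sub_eq_sq (X.presheaf.map (homOfLE h3).op ρ) ?_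
  apply germ_injective_of_isIntegral X x hxI
  rw [map_pow, map_sub]
  rw [X.presheaf.germ_res_apply (homOfLE h1) x hxI, X.presheaf.germ_res_apply (homOfLE h2) x hxI,
    X.presheaf.germ_res_apply (homOfLE h3) x hxI]
  exact hρ

variable [JacobsonSpace X]

include hX in
lemma unique (hs : Represents s c) (hs' : Represents s' c) : s = s' := by
  choose V hVW hxV hV using fun x : {x : X // x ∈ W ∧ IsClosed ({x} : Set X)} =>
    hs.exists_res_eq hX hs' x.2.1 x.2.2
  refine TopCat.Sheaf.eq_of_locally_eq' (raynaudSheaf X) V W (fun x => homOfLE (hVW x)) ?_ s s' hV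
  intro z hz
  obtain ⟨x, hxW, hx, hzx⟩ := exists_closed_point_specializes W.isOpen hz
  exact Opens.mem_iSup.mpr ⟨⟨x, hxW, hx⟩, hzx.mem_open (V _).isOpen (hxV _)⟩

include hX in
/-- An element of `k(X) / k(X)²` that is regular at all closed points of `W` corresponds to a
section over `W`. -/
lemma exists_of_regular (W : X.Opens) (c : ModSquares X.functionField)
    (hc : ∀ x ∈ W, IsClosed ({x} : Set X) → ∃ r : X.presheaf.stalk x,
      c = QuotientAddGroup.mk (algebraMap (X.presheaf.stalk x) X.functionField r)) :
    ∃ s : (raynaudSheaf X).obj.obj (op W), Represents s c := by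
  have hloc : ∀ x : {x : X // x ∈ W ∧ IsClosed ({x} : Set X)}, ∃ (V : X.Opens) (_ : V ≤ W)
      (_ : x.1 ∈ V) (s : (raynaudSheaf X).obj.obj (op V)), Represents s c := by
    rintro ⟨x, hxW, hx⟩
    obtain ⟨r, rfl⟩ := hc x hxW hx
    obtain ⟨V, hxV, g, rfl⟩ := X.presheaf.exists_germ_eq r
    have hne : Nonempty (V ⊓ W : X.Opens) := ⟨⟨x, hxV, hxW⟩⟩
    have hne' : Nonempty V := ⟨⟨x, hxV⟩⟩
    refine ⟨V ⊓ W, inf_le_right, ⟨hxV, hxW⟩,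
      raynaudSheaf.mk (V ⊓ W) (X.presheaf.map (homOfLE inf_le_left).op g), ?_⟩
    have h := Represents.mk (X.presheaf.map (homOfLE (inf_le_left : V ⊓ W ≤ V)).op g)
    rwa [germToFunctionField_res, ← Scheme.algebraMap_germ_eq_germToFunctionField X hxV] at h
  choose V hVW hxV t ht using hloc
  have hcov : W ≤ iSup V := by
    intro z hz
    obtain ⟨x, hxW, hx, hzx⟩ := exists_closed_point_specializes W.isOpen hz
    exact Opens.mem_iSup.mpr ⟨⟨x, hxW, hx⟩, hzx.mem_open (V _).isOpen (hxV _)⟩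
  obtain ⟨s, hs, -⟩ := TopCat.Sheaf.existsUnique_gluing' (raynaudSheaf X) V W
    (fun x => homOfLE (hVW x)) hcov t
    (fun x y => ((ht x).res inf_le_left).unique hX ((ht y).res inf_le_right))
  refine ⟨s, fun z hz => ?_⟩
  obtain ⟨x, hzx⟩ := Opens.mem_iSup.mp (hcov hz)
  obtain ⟨Z, hZ, hzZ, hne, g, hg, hgc⟩ := ht x z hzx
  refine ⟨Z, hZ.trans (hVW x), hzZ, hne, g, ?_, hgc⟩
  rw [← hg, ← hs x]
  exact (raynaudSheaf.res_res hZ (hVW x) s).symm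

end Represents

end CharTwoCurve

/-! ### Smooth algebras of relative dimension one -/

section Smooth

open KaehlerDifferential

open scoped KaehlerDifferential

/-- A submersive presentation gives a basis of the module of differentials that consists of
differentials of generators; in relative dimension one it has a single element. -/
lemma exists_basis_D_of_isStandardSmooth_one (k S : Type*) [CommRing k] [CommRing S]
    [Nontrivial S] [Algebra k S] [Algebra.IsStandardSmoothOfRelativeDimension 1 k S] :
    ∃ (f : S) (b : Module.Basis Unit S Ω[S⁄k]), b () = D k S f := by
  obtain ⟨ι, σ, _, _, ⟨P, hP⟩⟩ := ‹Algebra.IsStandardSmoothOfRelativeDimension 1 k S›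
  have := Fintype.ofFinite ((Set.range P.map)ᶜ : Set _)
  have hrank := P.rank_kaehlerDifferential
  rw [hP, rank_eq_card_basis P.basisKaehler, Nat.cast_inj, Fintype.card_eq_one_iff] at hrank
  obtain ⟨i, hi⟩ := hrank
  let e : ((Set.range P.map)ᶜ : Set _) ≃ Unit :=
    ⟨fun _ => (), fun _ => i, fun j => (hi j).symm, fun _ => rfl⟩
  exact ⟨P.val i, P.basisKaehler.reindex e, by simp [e]⟩

lemma exists_basis_D_of_isLocalization {k S : Type*} [CommRing k] [CommRing S] [Algebra k S]
    {f : S} (b : Module.Basis Unit S Ω[S⁄k]) (hb : b () = D k S f) (M : Submonoid S) (T : Type*)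
    [CommRing T] [Algebra S T] [Algebra k T] [IsScalarTower k S T] [IsLocalization M T] :
    ∃ b : Module.Basis Unit T Ω[T⁄k], b () = D k T (algebraMap S T f) := by
  refine ⟨b.ofIsLocalizedModule T M (map k k S T), ?_⟩
  rw [Module.Basis.ofIsLocalizedModule_apply, hb, map_D]

/-- If `df` is a basis of the differentials of `A` over `k` and its image in the differentials of a
quotient `B` of `A` over a `k`-algebra `C` vanishes, then `B` is unramified over `C`. -/
lemma kaehlerDifferential_subsingleton_of_D_eq_zero {k A B C : Type*} [CommRing k] [CommRing A]
    [CommRing B] [CommRing C] [Algebra k A] [Algebra k B] [Algebra A B] [IsScalarTower k A B]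
    [Algebra C B] [Algebra k C] [IsScalarTower k C B]
    (hAB : Function.Surjective (algebraMap A B)) {f : A}
    (b : Module.Basis Unit A Ω[A⁄k]) (hb : b () = D k A f)
    (hf : D C B (algebraMap A B f) = 0) : Subsingleton Ω[B⁄C] := by
  have hD : ∀ x : B, D C B x = 0 := by
    intro x
    obtain ⟨x, rfl⟩ := hAB x
    rw [← map_D k C, ← b.sum_repr (D k A x)]
    simp [hb, hf]
  rw [← Submodule.subsingleton_iff B, ← subsingleton_iff_bot_eq_top, ← span_range_derivation C B,
    eq_comm, Submodule.span_eq_bot]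
  rintro _ ⟨x, rfl⟩
  exact hD x

variable {k K : Type*} [Field k] [Field K] [Algebra k K]

/-- If `df` is a basis of the differentials of a function field `K` over a perfect field `k`, then
`K` is unramified, hence separable, over `k(f)`. Therefore `K` is generated by its squares over
`k(f)`, and every element of `k(f)` has the form `a² + b² f` because `k` is perfect. -/
lemma IsTwoBasis.of_basis_D [CharP k 2] [PerfectField k] [Algebra.EssFiniteType k K] {f : K}
    (b : Module.Basis Unit K Ω[K⁄k]) (hb : b () = D k K f) : IsTwoBasis f := by
  have hK : CharP K 2 := charP_of_injective_algebraMap (algebraMap k K).injective 2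
  have hmul : ∀ x y : K, (∃ a b, x = a ^ 2 + b ^ 2 * f) → (∃ a b, y = a ^ 2 + b ^ 2 * f) →
      ∃ a b, x * y = a ^ 2 + b ^ 2 * f := by
    rintro _ _ ⟨a, b, rfl⟩ ⟨c, d, rfl⟩
    refine ⟨a * c + b * d * f, a * d + b * c, ?_⟩
    rw [CharTwo.add_sq, CharTwo.add_sq]
    ring
  have hadd : ∀ x y : K, (∃ a b, x = a ^ 2 + b ^ 2 * f) → (∃ a b, y = a ^ 2 + b ^ 2 * f) →
      ∃ a b, x + y = a ^ 2 + b ^ 2 * f := by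
    rintro _ _ ⟨a, b, rfl⟩ ⟨c, d, rfl⟩
    refine ⟨a + c, b + d, ?_⟩
    rw [CharTwo.add_sq, CharTwo.add_sq]
    ring
  have hsq : ∀ x : K, ∃ a b, x ^ 2 = a ^ 2 + b ^ 2 * f := fun x => ⟨x, 0, by ring⟩
  have hinv : ∀ x : K, (∃ a b, x = a ^ 2 + b ^ 2 * f) → ∃ a b, x⁻¹ = a ^ 2 + b ^ 2 * f := by
    intro x hx
    by_cases h0 : x = 0
    · exact ⟨0, 0, by simp [h0]⟩
    · have : x⁻¹ = x * x⁻¹ ^ 2 := by field_simp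
      rw [this]
      exact hmul _ _ hx (hsq _)
  let F := IntermediateField.adjoin k {f}
  have hF : ∀ x ∈ F, ∃ a b, x = a ^ 2 + b ^ 2 * f := by
    intro x hx
    induction hx using IntermediateField.adjoin_induction with
    | mem x hx =>
      rw [Set.mem_singleton_iff.mp hx]
      exact ⟨0, 1, by ring⟩
    | algebraMap x =>
      obtain ⟨y, rfl⟩ := surjective_frobenius k 2 x
      rw [frobenius_def, map_pow]
      exact hsq _
    | add x y _ _ hx hy => exact hadd x y hx hy
    | inv x _ hx => exact hinv x hx
    | mul x y _ _ hx hy => exact hmul x y hx hy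
  have hunr : Algebra.FormallyUnramified F K := by
    constructor
    refine kaehlerDifferential_subsingleton_of_D_eq_zero (C := F) Function.surjective_id b hb ?_
    exact (D F K).map_algebraMap ⟨f, IntermediateField.subset_adjoin k {f} rfl⟩
  have hess : Algebra.EssFiniteType F K := Algebra.EssFiniteType.of_comp k F K
  have hsep : Algebra.IsSeparable F K := Algebra.FormallyUnramified.isSeparable F K
  have hchar : CharP F 2 := charP_of_injective_algebraMap (algebraMap k F).injective 2
  have htop := IntermediateField.adjoin_eq_adjoin_pow_expChar_of_isSeparable' F K Set.univ 2
  refine ⟨fun x => ?_, ?_⟩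
  · have hx : x ∈ IntermediateField.adjoin F ((· ^ 2) '' (Set.univ : Set K)) := by
      rw [← htop]
      exact IntermediateField.subset_adjoin _ _ trivial
    induction hx using IntermediateField.adjoin_induction with
    | mem x hx =>
      obtain ⟨y, -, rfl⟩ := hx
      exact hsq y
    | algebraMap x => exact hF x x.2
    | add x y _ _ hx hy => exact hadd x y hx hy
    | inv x _ hx => exact hinv x hx
    | mul x y _ _ hx hy => exact hmul x y hx hy
  -- The differential of a square is zero, but `df` is part of a basis.
  · rintro a rfl
    apply b.ne_zero ()
    rw [hb, Derivation.leibniz_pow, ← Nat.cast_smul_eq_nsmul K]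
    rw [Nat.cast_ofNat, CharTwo.two_eq_zero, zero_smul]

/-- Over an algebraically closed field `k`, let `R` be the local ring of a smooth curve at a
closed point, and let `f` be such that `df` is a basis of the module of differentials. If `f`
vanishes at the point up to a constant `c`, then `f - c` is a uniformizer: the ring `R / (f - c)` is
local and unramified over `k`, hence it is `k`. -/
lemma isDiscreteValuationRing_of_basis_D [IsAlgClosed k] {R : Type*} [CommRing R] [IsDomain R]
    [IsLocalRing R] [IsNoetherianRing R] [Algebra k R] [Algebra.EssFiniteType k R] {f : R}
    (b : Module.Basis Unit R Ω[R⁄k]) (hb : b () = D k R f) {c : k}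
    (hc : f - algebraMap k R c ∈ IsLocalRing.maximalIdeal R) :
    IsDiscreteValuationRing R ∧ Irreducible (f - algebraMap k R c) := by
  set t := f - algebraMap k R c
  let A := R ⧸ Ideal.span {t}
  have hle : Ideal.span {t} ≤ IsLocalRing.maximalIdeal R :=
    (Ideal.span_singleton_le_iff_mem _).mpr hc
  have hnt : Nontrivial A := Ideal.Quotient.nontrivial_iff.mpr
    (ne_top_of_le_ne_top (Ideal.IsPrime.ne_top inferInstance) hle)
  have hloc : IsLocalRing A := IsLocalRing.of_surjective' (Ideal.Quotient.mk _)
    Ideal.Quotient.mk_surjective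
  have hunr : Algebra.FormallyUnramified k A := by
    constructor
    refine kaehlerDifferential_subsingleton_of_D_eq_zero (C := k) Ideal.Quotient.mk_surjective b
      hb ?_
    have h1 : Ideal.Quotient.mk (Ideal.span {t}) f = algebraMap k A c := by
      rw [IsScalarTower.algebraMap_apply k R A, ← sub_eq_zero]
      exact (map_sub (Ideal.Quotient.mk (Ideal.span {t})) _ _).symm.trans
        (Ideal.Quotient.eq_zero_iff_mem.mpr (Ideal.mem_span_singleton_self t))
    exact (congrArg (D k A) h1).trans ((D k A).map_algebraMap c)
  have hess : Algebra.EssFiniteType k A := Algebra.EssFiniteType.comp k R A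
  have hfield := Algebra.FormallyUnramified.isField_of_isAlgClosed_of_isLocalRing k A
  have hmax : IsLocalRing.maximalIdeal R = Ideal.span {t} :=
    (IsLocalRing.eq_maximalIdeal (Ideal.Quotient.maximal_of_isField _ hfield)).symm
  have ht : t ≠ 0 := by
    intro h0
    apply b.ne_zero ()
    rw [hb, sub_eq_zero.mp h0, Derivation.map_algebraMap]
  have hnf : ¬ IsField R := by
    rw [IsLocalRing.isField_iff_maximalIdeal_eq, hmax, Ideal.span_singleton_eq_bot]
    exact ht
  have hprin : (IsLocalRing.maximalIdeal R).IsPrincipal := ⟨t, hmax⟩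
  have hdvr : IsDiscreteValuationRing R :=
    ((IsDiscreteValuationRing.TFAE R hnf).out 4 0).mp hprin
  exact ⟨hdvr, (IsDiscreteValuationRing.irreducible_iff_uniformizer t).mpr hmax⟩

end Smooth

/-! ### Local structure of a smooth curve at a closed point -/

namespace CharTwoCurve

variable {k : Type u} [Field k] {X : Scheme.{u}} (π : X ⟶ Spec (.of k))

/-- The embedding of the constants `k` into the sections over `V` of the structure sheaf of a
`k`-scheme. -/
def sectionConstants (V : X.Opens) : k →+* Γ(X, V) :=
  (π.appLE ⊤ V le_top).hom.comp (Scheme.ΓSpecIso (.of k)).inv.hom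

/-- The embedding of the constants `k` into a stalk of the structure sheaf of a `k`-scheme. -/
def stalkConstants (x : X) : k →+* X.presheaf.stalk x :=
  (X.presheaf.germ ⊤ x trivial).hom.comp
    (π.appTop.hom.comp (Scheme.ΓSpecIso (.of k)).inv.hom)

lemma germ_sectionConstants {V : X.Opens} {x : X} (hx : x ∈ V) (c : k) :
    X.presheaf.germ V x hx (sectionConstants π V c) = stalkConstants π x c :=
  X.presheaf.germ_res_apply (homOfLE le_top) x hx _

lemma algebraMap_stalkConstants [IsIntegral X] (x : X) (c : k) :
    algebraMap (X.presheaf.stalk x) X.functionField (stalkConstants π x c) = constants π c := by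
  have : Nonempty (⊤ : X.Opens) := ⟨⟨x, trivial⟩⟩
  exact Scheme.algebraMap_germ_eq_germToFunctionField X (U := ⊤) (x := x) trivial _

/-- Over an algebraically closed field every element of the local ring at a closed point is
congruent to a constant modulo the maximal ideal. -/
lemma exists_sub_stalkConstants_mem [IsAlgClosed k] [LocallyOfFiniteType π] {x : X}
    (hx : IsClosed ({x} : Set X)) (s : X.presheaf.stalk x) :
    ∃ c : k, s - stalkConstants π x c ∈ IsLocalRing.maximalIdeal (X.presheaf.stalk x) := by
  have key : (residueFieldIsoBase π x hx).inv =
      CommRingCat.ofHom ((X.residue x).hom.comp (stalkConstants π x)) := by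
    apply Spec.map_injective
    rw [SpecMap_residueFieldIsoBase_inv]
    have : CommRingCat.ofHom ((X.residue x).hom.comp (stalkConstants π x)) =
        (Scheme.ΓSpecIso (.of k)).inv ≫ π.appTop ≫ X.presheaf.germ ⊤ x trivial ≫ X.residue x := rfl
    rw [this]
    simp only [Spec.map_comp, Category.assoc, Scheme.fromSpecResidueField]
    rw [← Scheme.fromSpecStalk_toSpecΓ]
    simp only [Category.assoc]
    rw [← Scheme.toSpecΓ_naturality_assoc, toSpecΓ_SpecMap_ΓSpecIso_inv, Category.comp_id]
  refine ⟨(residueFieldIsoBase π x hx).hom (X.residue x s), ?_⟩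
  rw [← Ideal.Quotient.eq_zero_iff_mem, map_sub, sub_eq_zero]
  have h := congrArg (fun φ => φ.hom ((residueFieldIsoBase π x hx).hom (X.residue x s))) key
  exact (((residueFieldIsoBase π x hx).hom_inv_id_apply _).symm.trans h :
    X.residue x s = X.residue x (stalkConstants π x _))

variable [IsIntegral X]

/-- A smooth curve over an algebraically closed field of characteristic two is covered by affine
opens `V` with a regular function `f` that is a 2-basis of the function field and whose translate
`f - f(y)` is a uniformizer at every closed point `y` of `V`. -/
lemma exists_local_coordinate [IsAlgClosed k] [CharP k 2] [LocallyOfFiniteType π]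
    [SmoothOfRelativeDimension 1 π] (x : X) :
    ∃ (V : X.Opens) (f : X.functionField), x ∈ V ∧ IsTwoBasis f ∧
      ∀ y ∈ V, IsClosed ({y} : Set X) → IsDiscreteValuationRing (X.presheaf.stalk y) ∧
        ∃ (c : k) (ϖ : X.presheaf.stalk y), Irreducible ϖ ∧
          algebraMap (X.presheaf.stalk y) X.functionField ϖ = f - constants π c := by
  have : IsLocallyNoetherian X := LocallyOfFiniteType.isLocallyNoetherian π
  obtain ⟨U, -, V, hV, hxV, e, hsm⟩ :=
    SmoothOfRelativeDimension.exists_isStandardSmoothOfRelativeDimension (n := 1) (f := π) x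
  -- The spectrum of a field is a point, so that the open `U` is the whole spectrum.
  have hU : U = ⊤ := by
    ext p
    have hp : p = π x := Subsingleton.elim (α := PrimeSpectrum k) _ _
    simpa [hp] using e hxV
  subst hU
  have hsm' : (sectionConstants π V).IsStandardSmoothOfRelativeDimension 1 :=
    hsm.comp (RingHom.IsStandardSmoothOfRelativeDimension.equiv
      (Scheme.ΓSpecIso (.of k)).symm.commRingCatIsoToRingEquiv)
  let : Algebra k Γ(X, V) := (sectionConstants π V).toAlgebra
  have : Algebra.IsStandardSmoothOfRelativeDimension 1 k Γ(X, V) := hsm'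
  have : Algebra.IsStandardSmooth k Γ(X, V) :=
    Algebra.IsStandardSmoothOfRelativeDimension.isStandardSmooth 1
  have : Nonempty V := ⟨⟨x, hxV⟩⟩
  obtain ⟨f, b, hb⟩ := exists_basis_D_of_isStandardSmooth_one k Γ(X, V)
  have hcomp : ∀ (y : X) (hy : y ∈ V),
      (X.presheaf.germ V y hy).hom.comp (sectionConstants π V) = stalkConstants π y :=
    fun y hy => RingHom.ext (germ_sectionConstants π hy)
  refine ⟨V, X.germToFunctionField V f, hxV, ?_, fun y hy hyc => ?_⟩
  · let : Algebra k X.functionField := (constants π).toAlgebra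
    have : IsScalarTower k Γ(X, V) X.functionField := .of_algebraMap_eq' (hcomp _ _).symm
    have := functionField_isFractionRing_of_isAffineOpen X V hV
    obtain ⟨b', hb'⟩ := exists_basis_D_of_isLocalization b hb (nonZeroDivisors Γ(X, V))
      X.functionField
    have : Algebra.EssFiniteType Γ(X, V) X.functionField :=
      .of_isLocalization _ (nonZeroDivisors Γ(X, V))
    have : Algebra.EssFiniteType k X.functionField := .comp k Γ(X, V) X.functionField
    exact IsTwoBasis.of_basis_D (k := k) b' hb'
  · let : Algebra k (X.presheaf.stalk y) := (stalkConstants π y).toAlgebra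
    let : Algebra Γ(X, V) (X.presheaf.stalk y) := X.presheaf.algebra_section_stalk ⟨y, hy⟩
    have : IsScalarTower k Γ(X, V) (X.presheaf.stalk y) := .of_algebraMap_eq' (hcomp y hy).symm
    have : IsLocalization.AtPrime (X.presheaf.stalk y) (hV.primeIdealOf ⟨y, hy⟩).asIdeal :=
      hV.isLocalization_stalk ⟨y, hy⟩
    obtain ⟨b', hb'⟩ := exists_basis_D_of_isLocalization b hb
      (hV.primeIdealOf ⟨y, hy⟩).asIdeal.primeCompl (X.presheaf.stalk y)
    have : Algebra.EssFiniteType Γ(X, V) (X.presheaf.stalk y) :=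
      .of_isLocalization _ (hV.primeIdealOf ⟨y, hy⟩).asIdeal.primeCompl
    have : Algebra.EssFiniteType k (X.presheaf.stalk y) := .comp k Γ(X, V) _
    obtain ⟨c, hc⟩ := exists_sub_stalkConstants_mem π hyc (X.presheaf.germ V y hy f)
    obtain ⟨hdvr, hirr⟩ := isDiscreteValuationRing_of_basis_D b' hb' hc
    refine ⟨hdvr, c, _, hirr, ?_⟩
    rw [map_sub]
    congr 1
    · exact Scheme.algebraMap_germ_eq_germToFunctionField X hy f
    · exact algebraMap_stalkConstants π y c

lemma isDiscreteValuationRing_stalk [IsAlgClosed k] [CharP k 2] [LocallyOfFiniteType π]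
    [SmoothOfRelativeDimension 1 π] {x : X} (hx : IsClosed ({x} : Set X)) :
    IsDiscreteValuationRing (X.presheaf.stalk x) := by
  obtain ⟨V, f, hxV, -, h⟩ := exists_local_coordinate π x
  exact (h x hxV hx).1

lemma coheight_eq_one_of_isDiscreteValuationRing (x : X)
    [IsDiscreteValuationRing (X.presheaf.stalk x)] : Order.coheight x = 1 := by
  have h1 := ringKrullDim_stalk_eq_coheight x
  rw [IsDiscreteValuationRing.ringKrullDim_eq_one] at h1
  exact_mod_cast h1.symm

lemma ord_algebraMap_irreducible [IsLocallyNoetherian X] {x : X}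
    [IsDiscreteValuationRing (X.presheaf.stalk x)] {ϖ : X.presheaf.stalk x} (hϖ : Irreducible ϖ) :
    Scheme.ord (algebraMap (X.presheaf.stalk x) X.functionField ϖ) x = 1 := by
  have hinj := IsFractionRing.injective (X.presheaf.stalk x) X.functionField
  rw [Scheme.ord_eq_iff (coheight_eq_one_of_isDiscreteValuationRing x)
    ((map_ne_zero_iff _ hinj).mpr hϖ.ne_zero)]
  exact Ring.ordFrac_irreducible hϖ

lemma ord_algebraMap_unit_mul_pow [IsLocallyNoetherian X] {x : X}
    [IsDiscreteValuationRing (X.presheaf.stalk x)] {ϖ : X.presheaf.stalk x} (hϖ : Irreducible ϖ)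
    (ε : (X.presheaf.stalk x)ˣ) (n : ℕ) :
    Scheme.ord (algebraMap (X.presheaf.stalk x) X.functionField (ε * ϖ ^ n)) x = n := by
  have hinj := IsFractionRing.injective (X.presheaf.stalk x) X.functionField
  have hcoh := coheight_eq_one_of_isDiscreteValuationRing x
  have hne : ∀ {r : X.presheaf.stalk x}, r ≠ 0 →
      algebraMap (X.presheaf.stalk x) X.functionField r ≠ 0 :=
    fun h => (map_ne_zero_iff _ hinj).mpr h
  induction n with
  | zero =>
    rw [pow_zero, mul_one, Scheme.ord_eq_iff hcoh (hne ε.ne_zero)]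
    exact Ring.ordFrac_of_isUnit ε.isUnit
  | succ n ih =>
    rw [pow_succ, ← mul_assoc, map_mul, Scheme.ord_mul
      (hne (mul_ne_zero ε.ne_zero (pow_ne_zero _ hϖ.ne_zero))) (hne hϖ.ne_zero), ih,
      ord_algebraMap_irreducible hϖ]
    push_cast
    rfl

/-- At a closed point of a smooth curve, pseudo-tameness is a property of the discrete valuation
ring at that point; the constant `c` is absorbed by the fourth power. -/
lemma IsPseudoTameAt.isPseudoTameDVR [IsAlgClosed k] [CharP k 2] [CharP X.functionField 2]
    [LocallyOfFiniteType π] [SmoothOfRelativeDimension 1 π] {f : X.functionField} {x : X}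
    [IsDiscreteValuationRing (X.presheaf.stalk x)]
    (hf : IsPseudoTameAt π f x) : IsPseudoTameDVR (X.presheaf.stalk x) f := by
  have : IsLocallyNoetherian X := LocallyOfFiniteType.isLocallyNoetherian π
  obtain ⟨t, -, ht, h, hodd⟩ := hf
  obtain ⟨ϖ, hϖ⟩ := IsDiscreteValuationRing.exists_irreducible (X.presheaf.stalk x)
  have hne : t + h ^ 4 ≠ 0 := by
    intro h0
    rw [h0, map_zero, Scheme.ord_zero] at hodd
    simp at hodd
  obtain ⟨n, ε, hn⟩ := IsDiscreteValuationRing.eq_unit_mul_pow_irreducible hne hϖ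
  rw [hn, ord_algebraMap_unit_mul_pow hϖ, Int.odd_coe_nat] at hodd
  obtain ⟨m, rfl⟩ := hodd
  have h4 : ∀ a b : X.functionField, (a + b) ^ 4 = a ^ 4 + b ^ 4 := by
    intro a b
    have : ∀ c : X.functionField, c ^ 4 = (c ^ 2) ^ 2 := fun c => by ring
    rw [this, CharTwo.add_sq, CharTwo.add_sq, ← this, ← this]
  obtain ⟨c, ht⟩ | ht := ht
  · obtain ⟨d, rfl⟩ := IsAlgClosed.exists_pow_nat_eq c four_pos
    refine ⟨ϖ, ε, m, constants π d + algebraMap _ _ h, hϖ, Or.inl ?_⟩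
    rw [← hn, map_add, ht, h4, map_pow, map_pow, CharTwo.sub_eq_add, add_assoc]
  · refine ⟨ϖ, ε, m, algebraMap _ _ h, hϖ, Or.inr ?_⟩
    rw [← hn, map_add, map_pow, add_assoc, CharTwo.add_self_eq_zero, add_zero, ht]

/-- Every point has an open neighbourhood on which some rational function is pseudo-tame: a local
coordinate. -/
lemma exists_isPseudoTameOn [IsAlgClosed k] [CharP k 2] [LocallyOfFiniteType π]
    [SmoothOfRelativeDimension 1 π] (x : X) :
    ∃ (V : X.Opens) (f : X.functionField), x ∈ V ∧ IsPseudoTameOn π f V := by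
  have : IsLocallyNoetherian X := LocallyOfFiniteType.isLocallyNoetherian π
  obtain ⟨V, f, hxV, -, h⟩ := exists_local_coordinate π x
  refine ⟨V, f, hxV, fun y hy hyc => ?_⟩
  obtain ⟨_, c, ϖ, hϖ, hc⟩ := h y hy hyc
  refine ⟨ϖ, (IsLocalRing.mem_maximalIdeal _).mpr hϖ.not_isUnit, Or.inl ⟨c, hc⟩, 0, ?_⟩
  rw [zero_pow four_ne_zero, add_zero, ord_algebraMap_irreducible hϖ]
  exact odd_one

end CharTwoCurve

/-! ### The obstruction class -/

namespace CharTwoCurve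

variable {k : Type u} [Field k] {X : Scheme.{u}} [IsIntegral X] (π : X ⟶ Spec (.of k))

include π in
lemma charP_functionField [CharP k 2] : CharP X.functionField 2 :=
  charP_of_injective_ringHom (constants π).injective 2

variable {π}

lemma IsObstructionCocycle.reindex {ι κ : Type u} {U : κ → X.Opens} {f : κ → X.functionField}
    {s : CechH1.OneCocycle (raynaudSheaf X) U} (hs : IsObstructionCocycle f s) (r : ι → κ) :
    IsObstructionCocycle (fun i => f (r i)) (s.reindex r) :=
  fun i j => hs (r i) (r j)

namespace IsPseudoTameCovering

section

variable [LocallyOfFiniteType π] {ι κ : Type u} {U : ι → X.Opens} {f : ι → X.functionField}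
  {V : κ → X.Opens} {g : κ → X.functionField}

/-- The disjoint union of two pseudo-tame coverings. -/
lemma sum (hU : IsPseudoTameCovering π U f) (hV : IsPseudoTameCovering π V g) :
    IsPseudoTameCovering π (Sum.elim U V) (Sum.elim f g) where
  covers := by
    rw [iSup_sum, eq_top_iff]
    exact hU.covers.ge.trans le_sup_left
  nonempty := by
    rintro (i | i)
    · exact hU.nonempty i
    · exact hV.nonempty i
  pseudoTame := by
    rintro (i | i)
    · exact hU.pseudoTame i
    · exact hV.pseudoTame i

end

variable [IsAlgClosed k] [CharP k 2] [LocallyOfFiniteType π] [SmoothOfRelativeDimension 1 π]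
  {ι κ : Type u} {U : ι → X.Opens} {f : ι → X.functionField}
  {V : κ → X.Opens} {g : κ → X.functionField}

lemma isTwoBasis (h : IsPseudoTameCovering π U f) (i : ι) : IsTwoBasis (f i) := by
  have := charP_functionField π
  have : JacobsonSpace X := LocallyOfFiniteType.jacobsonSpace π
  obtain ⟨z, hz⟩ := h.nonempty i
  obtain ⟨x, hxU, hx, -⟩ := exists_closed_point_specializes (U i).isOpen hz
  obtain ⟨_, w, -, hw, -⟩ := exists_local_coordinate π x
  have := isDiscreteValuationRing_stalk π hx
  exact ((h.pseudoTame i x hxU hx).isPseudoTameDVR.isTwoBasis_and_regular hw).1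

/-- The cocycle relation holds because sections of `𝒪_X / 𝒪_X²` are determined by the corresponding
elements of `k(X) / k(X)²`, where it is the relation `a(f, g) + a(g, h) = a(f, h)`. -/
lemma existsUnique_isObstructionCocycle (h : IsPseudoTameCovering π U f) :
    ∃! s : CechH1.OneCocycle (raynaudSheaf X) U, IsObstructionCocycle f s := by
  have := charP_functionField π
  have : JacobsonSpace X := LocallyOfFiniteType.jacobsonSpace π
  have hX : ∀ x : X, IsClosed ({x} : Set X) → IsIntegrallyClosed (X.presheaf.stalk x) := by
    intro x hx
    have := isDiscreteValuationRing_stalk π hx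
    infer_instance
  have hex : ∀ i j, ∃ s : (raynaudSheaf X).obj.obj (op (U i ⊓ U j)),
      Represents s (aInvariant (f i) (f j)) := by
    intro i j
    refine Represents.exists_of_regular hX _ _ fun x hxU hx => ?_
    have := isDiscreteValuationRing_stalk π hx
    exact (h.pseudoTame i x hxU.1 hx).isPseudoTameDVR.aInvariant_regular (h.isTwoBasis i)
      (h.pseudoTame j x hxU.2 hx).isPseudoTameDVR
  choose s hs using hex
  refine ⟨⟨s, fun i j l => ?_⟩, hs, fun t ht => ?_⟩
  · refine (((hs i j).res inf_le_left).add ((hs j l).res _)).unique hX ?_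
    rw [(h.isTwoBasis i).aInvariant_add (h.isTwoBasis j) (h.isTwoBasis l)]
    exact (hs i l).res _
  · exact CechH1.OneCocycle.ext (funext fun i => funext fun j => (ht i j).unique hX (hs i j))

/-- Two pseudo-tame coverings are subfamilies of their disjoint union, hence they define the same
cohomology class. -/
lemma cohomologyClass_eq (hU : IsPseudoTameCovering π U f) (hV : IsPseudoTameCovering π V g)
    {s : CechH1.OneCocycle (raynaudSheaf X) U} (hs : IsObstructionCocycle f s)
    {t : CechH1.OneCocycle (raynaudSheaf X) V} (ht : IsObstructionCocycle g t) :
    s.cohomologyClass hU.covers = t.cohomologyClass hV.covers := by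
  have hUV := hU.sum hV
  obtain ⟨w, hw, -⟩ := hUV.existsUnique_isObstructionCocycle
  obtain rfl : s = w.reindex Sum.inl :=
    hU.existsUnique_isObstructionCocycle.unique hs (hw.reindex Sum.inl)
  obtain rfl : t = w.reindex Sum.inr :=
    hV.existsUnique_isObstructionCocycle.unique ht (hw.reindex Sum.inr)
  exact (w.cohomologyClass_reindex Sum.inl hUV.covers hU.covers).trans
    (w.cohomologyClass_reindex Sum.inr hUV.covers hV.covers).symm

variable (π) in
/-- Local coordinates give a pseudo-tame covering, indexed by the points of the curve. -/
lemma exists_covering : ∃ (U : X → X.Opens) (f : X → X.functionField),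
    IsPseudoTameCovering π U f := by
  choose U f hU hf using exists_isPseudoTameOn π
  exact ⟨U, f, eq_top_iff.mpr fun x _ => Opens.mem_iSup.mpr ⟨x, hU x⟩, fun x => ⟨x, hU x⟩, hf⟩

end IsPseudoTameCovering

end CharTwoCurve

end

theorem mainTheorem10 {k : Type u} [Field k] [IsAlgClosed k] [CharP k 2]
    (X : Scheme.{u}) (π : X ⟶ Spec (.of k))
    [IsIntegral X] [IsProper π] [SmoothOfRelativeDimension 1 π] :
    (∀ {ι : Type u} (U : ι → X.Opens) (f : ι → X.functionField),
      CharTwoCurve.IsPseudoTameCovering π U f →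
        ∃! s : CechH1.OneCocycle (CharTwoCurve.raynaudSheaf X) U,
          CharTwoCurve.IsObstructionCocycle f s) ∧
    ∃! β : Sheaf.H.{u} (CharTwoCurve.raynaudSheaf X) 1,
      ∀ {ι : Type u} (U : ι → X.Opens) (f : ι → X.functionField)
        (h : CharTwoCurve.IsPseudoTameCovering π U f)
        (s : CechH1.OneCocycle (CharTwoCurve.raynaudSheaf X) U),
        CharTwoCurve.IsObstructionCocycle f s → s.cohomologyClass h.covers = β := by
  refine ⟨fun U f h => h.existsUnique_isObstructionCocycle, ?_⟩
  obtain ⟨U, f, h⟩ := CharTwoCurve.IsPseudoTameCovering.exists_covering π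
  obtain ⟨s, hs, -⟩ := h.existsUnique_isObstructionCocycle
  exact ⟨s.cohomologyClass h.covers, fun V g h' t ht => h'.cohomologyClass_eq h ht hs,
    fun β hβ => (hβ U f h s hs).symm⟩
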